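/- Parikh's Theorem. Let $\Sigma$ be a finite alphabet. For a word $w \in \Sigma^*$ let $\Psi(w) = (|w|_a)_{a\in\Sigma} \in \mathbb{N}^{|\Sigma|}$, where $|w|_a$ denotes the number of occurrences of the letter $a$ in $w$, and for $L \subseteq \Sigma^*$ let $\Psi(L) = \{\Psi(w) \mid w \in L\}$ be its Parikh image. If $L \subseteq \Sigma^*$ is context-free, that is, generated by a context-free grammar, then $\Psi(L) \subseteq \mathbb{N}^{|\Sigma|}$ is semilinear, that is, a finite union of linear sets, where a set is linear if it has the form $\{u + x_1 v_1 + \cdots + x_n v_n \mid x_1,\ldots,x_n \in \mathbb{N}\}$ for some $n \geq 0$ and some vectors $u, v_1, \ldots, v_n \in \mathbb{N}^{|\Sigma|}$. -/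

import Mathlib

/-- The Parikh image `Ψ(w) = (|w|_a)_{a ∈ Σ}` of a word `w ∈ Σ*`: the vector of the numbers of
occurrences of the letters in `w`. -/
def parikhVector {α : Type*} [DecidableEq α] (w : List α) : α → ℕ :=
  fun a => w.count a

/-- The Parikh image `Ψ(L) = {Ψ(w) | w ∈ L}` of a language `L ⊆ Σ*`. -/
def parikhImage {α : Type*} [DecidableEq α] (L : Language α) : Set (α → ℕ) :=
  {v | ∃ w ∈ L, parikhVector w = v}

open Pointwise

/-! Parikh vectors depend only on which rules are used and how often, so it suffices that the rule
multisets of complete derivations form a semilinear set. Two of them differ by a balanced multiset;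
conversely, a balanced multiset splits into pumps `B → B` (`exists_pump`), each insertable wherever
`B` is rewritten (`insert_balanced`). So for each set of rewritten nonterminals, the derivations are
finitely many minimal ones plus a finitely generated monoid. -/

/-- Commutative context-free rewriting: from the multiset `M` of nonterminals, applying the rules in
the multiset `x` in some order leads to the multiset `K`. A rule `r` replaces one occurrence of
`src r` by `tgt r`. -/
inductive Fires {N R : Type*} (src : R → N) (tgt : R → Multiset N) :
    Multiset N → Multiset R → Multiset N → Prop
  | refl (M : Multiset N) : Fires src tgt M 0 M
  | step (r : R) {M K : Multiset N} {x : Multiset R} (h : Fires src tgt (tgt r + M) x K) :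
      Fires src tgt (src r ::ₘ M) (r ::ₘ x) K

/-- The submonoid of multisets of rules with sources in `U` that consume exactly what they produce. -/
def balancedSubmonoid {N R : Type*} (src : R → N) (tgt : R → Multiset N) (U : Set N) :
    AddSubmonoid (Multiset R) where
  carrier := {z | z.bind tgt = z.map src ∧ ∀ r ∈ z, src r ∈ U}
  zero_mem' := by simp
  add_mem' := by
    rintro a b ⟨ha, ha'⟩ ⟨hb, hb'⟩
    refine ⟨by simp [ha, hb], fun r hr => ?_⟩
    rcases Multiset.mem_add.1 hr with h | h
    exacts [ha' r h, hb' r h]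

theorem mem_balancedSubmonoid {N R : Type*} {src : R → N} {tgt : R → Multiset N} {U : Set N}
    {z : Multiset R} : z ∈ balancedSubmonoid src tgt U ↔
      z.bind tgt = z.map src ∧ ∀ r ∈ z, src r ∈ U := Iff.rfl

/-- Dickson's lemma. -/
instance Multiset.wellQuasiOrderedLE_of_finite {R : Type*} [Finite R] :
    WellQuasiOrderedLE (Multiset R) := by
  classical
  exact (Finsupp.orderIsoMultiset (ι := R)).wellQuasiOrderedLE_iff.1 inferInstance

namespace Fires

variable {N R : Type*} {src : R → N} {tgt : R → Multiset N}

theorem add_right {M K : Multiset N} {x : Multiset R} (h : Fires src tgt M x K) (L : Multiset N) :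
    Fires src tgt (M + L) x (K + L) := by
  induction h with
  | refl M => exact .refl _
  | step r h ih =>
    rw [Multiset.cons_add]
    exact .step r (by rwa [← add_assoc])

theorem trans {M K L : Multiset N} {x y : Multiset R} (h : Fires src tgt M x K)
    (h' : Fires src tgt K y L) : Fires src tgt M (x + y) L := by
  induction h with
  | refl M => rwa [zero_add]
  | step r h ih =>
    rw [Multiset.cons_add]
    exact .step r (ih h')

theorem balance {M K : Multiset N} {x : Multiset R} (h : Fires src tgt M x K) :
    M + x.bind tgt = x.map src + K := by
  induction h with
  | refl M => simp
  | @step r M K x h ih =>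
    rw [Multiset.cons_bind, Multiset.map_cons, Multiset.cons_add, Multiset.cons_add, ← ih]
    congr 1
    abel

/-- The pump runs just before `A` is first rewritten. -/
theorem insert_pump {M K : Multiset N} {x c : Multiset R} (h : Fires src tgt M x K) {A : N}
    (hA : A ∈ x.map src) (hc : Fires src tgt {A} c {A}) : Fires src tgt M (c + x) K := by
  induction h with
  | refl M => simp at hA
  | @step r M K x h ih =>
    rw [Multiset.map_cons, Multiset.mem_cons] at hA
    rcases hA with rfl | hA
    · have := hc.add_right M
      rw [Multiset.singleton_add] at this
      exact this.trans (.step r h)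
    · rw [Multiset.add_cons]
      exact .step r (ih hA)

/-- A multiset of nonterminals that is balanced by `w` can be erased using only rules of `w`. -/
theorem exists_erasing (w : Multiset R) (M : Multiset N) (h : M + w.bind tgt = w.map src) :
    ∃ d ≤ w, Fires src tgt M d 0 := by
  induction hn : Multiset.card w generalizing w M with
  | zero =>
    obtain rfl := Multiset.card_eq_zero.1 hn
    obtain rfl : M = 0 := by simpa using h
    exact ⟨0, le_rfl, .refl 0⟩
  | succ n ih =>
    rcases Multiset.empty_or_exists_mem M with rfl | ⟨X, hX⟩
    · exact ⟨0, Multiset.zero_le _, .refl 0⟩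
    have hX' : X ∈ w.map src := h ▸ Multiset.mem_add.2 (.inl hX)
    obtain ⟨r, hr, rfl⟩ := Multiset.mem_map.1 hX'
    obtain ⟨M, rfl⟩ := Multiset.exists_cons_of_mem hX
    obtain ⟨w, rfl⟩ := Multiset.exists_cons_of_mem hr
    obtain ⟨d, hd, hd'⟩ := ih w (tgt r + M) (by
      rw [Multiset.cons_bind, Multiset.map_cons, Multiset.cons_add, Multiset.cons_inj_right] at h
      rw [← h]; abel) (by simpa using hn)
    exact ⟨r ::ₘ d, Multiset.cons_le_cons r hd, .step r hd'⟩

/-- A nonempty derivation from a single nonterminal extends, within a balanced multiset of rules,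
to a nonempty derivation that reproduces a single nonterminal. -/
theorem exists_pump_of_fires (w c : Multiset R) {A : N} {K : Multiset N}
    (hb : (w + c).bind tgt = (w + c).map src) (hc : c ≠ 0) (h : Fires src tgt {A} c K) :
    ∃ B, ∃ d ≤ w + c, d ≠ 0 ∧ Fires src tgt {B} d {B} := by
  induction hn : Multiset.card w using Nat.strong_induction_on generalizing w c A K with
  | _ n ih =>
    have hbal : {A} + w.map src = w.bind tgt + K := by
      have := h.balance
      rw [Multiset.add_bind, Multiset.map_add] at hb
      apply add_right_cancel (b := c.map src)
      rw [add_assoc, ← hb, add_assoc, add_comm K, ← this]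
      abel
    have hA : A ∈ w.bind tgt + K := by rw [← hbal]; simp
    rcases Multiset.mem_add.1 hA with hA | hA
    -- An unused rule `r` produces `A`: prepend it to the derivation.
    · obtain ⟨r, hr, hAr⟩ := Multiset.mem_bind.1 hA
      obtain ⟨w, rfl⟩ := Multiset.exists_cons_of_mem hr
      obtain ⟨P, hP⟩ := Multiset.exists_cons_of_mem hAr
      have := ih (Multiset.card w) (by simp [← hn]) w (r ::ₘ c) (A := src r) (K := K + P)
        (by rwa [Multiset.add_cons, ← Multiset.cons_add]) Multiset.cons_ne_zero
        (.step r (M := 0) (by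
          rw [hP, add_zero, ← Multiset.singleton_add]
          exact h.add_right P)) rfl
      rwa [Multiset.add_cons, ← Multiset.cons_add] at this
    -- `A` recurs in the result, and `w` balances the rest, which can thus be erased.
    · obtain ⟨K, rfl⟩ := Multiset.exists_cons_of_mem hA
      obtain ⟨d, hd, hd'⟩ := exists_erasing (src := src) (tgt := tgt) w K (by
        rw [Multiset.singleton_add, Multiset.add_cons, Multiset.cons_inj_right] at hbal
        rw [hbal, add_comm])
      refine ⟨A, c + d, by rw [add_comm]; gcongr, by simp [hc], h.trans ?_⟩
      simpa [add_comm K] using hd'.add_right {A}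

theorem exists_pump {z : Multiset R} (hz : z ≠ 0) (hb : z.bind tgt = z.map src) :
    ∃ B, ∃ d ≤ z, d ≠ 0 ∧ Fires src tgt {B} d {B} := by
  obtain ⟨r, hr⟩ := Multiset.exists_mem_of_ne_zero hz
  obtain ⟨w, rfl⟩ := Multiset.exists_cons_of_mem hr
  rw [← Multiset.singleton_add, add_comm] at hb ⊢
  exact exists_pump_of_fires w {r} hb (by simp) (.step r (M := 0) (.refl _))

theorem mem_map_src_of_pump {B : N} {d : Multiset R} (hd : d ≠ 0) (h : Fires src tgt {B} d {B}) :
    B ∈ d.map src := by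
  generalize hM : ({B} : Multiset N) = M at h
  cases h with
  | refl => exact absurd rfl hd
  | step r h =>
    have : B = src r := by
      have : src r ∈ ({B} : Multiset N) := hM ▸ Multiset.mem_cons_self _ _
      exact (Multiset.mem_singleton.1 this).symm
    simp [this]

/-- A balanced multiset of rules whose sources all occur in a derivation can be inserted in it. -/
theorem insert_balanced (z : Multiset R) {M K : Multiset N} {x : Multiset R}
    (h : Fires src tgt M x K) (hz : z ∈ balancedSubmonoid src tgt {A | A ∈ x.map src}) :
    Fires src tgt M (x + z) K := by
  induction hn : Multiset.card z using Nat.strong_induction_on generalizing z x with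
  | _ n ih =>
    obtain rfl | hne := eq_or_ne z 0
    · simpa using h
    obtain ⟨hb, hU⟩ := hz
    obtain ⟨B, d, hdz, hd, hdB⟩ := exists_pump hne hb
    obtain ⟨z, rfl⟩ := Multiset.le_iff_exists_add.1 hdz
    have hBx : B ∈ x.map src := by
      obtain ⟨r, hr, rfl⟩ := Multiset.mem_map.1 (mem_map_src_of_pump hd hdB)
      exact hU r (Multiset.mem_add.2 (.inl hr))
    have hbd : d.bind tgt = d.map src := by
      have := hdB.balance
      rw [add_comm (d.map src)] at this
      exact add_left_cancel this
    -- Without the pump `z` stays balanced, and the longer derivation still rewrites all its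
    -- sources.
    have := ih (Multiset.card z) (by
      rw [← hn, Multiset.card_add]
      have := Multiset.card_pos.2 hd
      omega) z (h.insert_pump hBx hdB) ⟨by
        rw [Multiset.add_bind, Multiset.map_add, hbd] at hb
        exact add_left_cancel hb, fun r hr => by
        have := hU r (Multiset.mem_add.2 (.inr hr))
        rw [Set.mem_ofPred_eq] at this ⊢
        rw [Multiset.map_add]
        exact Multiset.mem_add.2 (.inr this)⟩ rfl
    rwa [add_comm d, add_assoc] at this

end Fires

/-- Balanced multisets are closed under subtraction, so the minimal nonzero ones generate; Dickson's
lemma makes them finitely many. -/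
theorem balancedSubmonoid_fg {N R : Type*} [Finite R] (src : R → N) (tgt : R → Multiset N)
    (U : Set N) : (balancedSubmonoid src tgt U).FG := by
  refine AddSubmonoid.fg_of_subtractive fun x hx y hxy => ?_
  rw [mem_balancedSubmonoid] at hx hxy ⊢
  rw [Multiset.add_bind, Multiset.map_add, hx.1] at hxy
  exact ⟨add_left_cancel hxy.1, fun r hr => hxy.2 r (Multiset.mem_add.2 (.inr hr))⟩

/-- The multisets of rules of complete derivations form a semilinear set. -/
theorem isSemilinearSet_setOf_fires {N R : Type*} [Finite R] (src : R → N) (tgt : R → Multiset N)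
    (M K : Multiset N) : IsSemilinearSet {x | Fires src tgt M x K} := by
  -- Indexing by sets of rules keeps the union finite even when `N` is infinite.
  let P : Set R → Multiset R → Prop := fun U x =>
    Fires src tgt M x K ∧ {A | A ∈ x.map src} = src '' U
  have key : {x | Fires src tgt M x K} = ⋃ U : Set R, ⋃ m ∈ {m | Minimal (P U) m},
      m +ᵥ (balancedSubmonoid src tgt (src '' U) : Set (Multiset R)) := by
    ext x
    simp only [Set.mem_ofPred_eq, Set.mem_iUnion, Set.mem_vadd_set, SetLike.mem_coe, vadd_eq_add,
      exists_prop]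
    constructor
    · intro hx
      obtain ⟨m, hmx, hm⟩ := exists_minimal_le_of_wellFoundedLT (P {r | r ∈ x}) x
        ⟨hx, by ext; simp⟩
      obtain ⟨z, rfl⟩ := Multiset.le_iff_exists_add.1 hmx
      refine ⟨_, m, hm, z, ⟨?_, fun r hr => ⟨r, Multiset.mem_add.2 (.inr hr), rfl⟩⟩, rfl⟩
      have h₁ := hx.balance
      have h₂ := hm.prop.1.balance
      rw [Multiset.add_bind, Multiset.map_add, ← add_assoc, h₂, add_assoc, add_assoc,
        add_left_cancel_iff, add_comm] at h₁
      exact add_right_cancel h₁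
    · rintro ⟨U, m, hm, z, hz, rfl⟩
      exact hm.prop.1.insert_balanced z (hm.prop.2 ▸ hz)
  rw [key]
  refine .iUnion fun U => .biUnion ?_ fun m _ => .vadd m (.of_fg (balancedSubmonoid_fg src tgt _))
  exact WellQuasiOrderedLE.finite_of_isAntichain (setOfPred_minimal_antichain (P U))

/-! ### From grammars to commutative rewriting -/

namespace ContextFreeGrammar

variable {T : Type*} {g : ContextFreeGrammar T}

/-- The multiset of nonterminals in a sentential form. -/
def nonterminals {T N : Type*} (u : List (Symbol T N)) : Multiset N :=
  Multiset.filterMap (fun s : Symbol T N => match s with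
    | .nonterminal A => some A
    | .terminal _ => none) u

/-- The multiset of terminals in a sentential form. -/
def terminals {T N : Type*} (u : List (Symbol T N)) : Multiset T :=
  Multiset.filterMap (fun s : Symbol T N => match s with
    | .terminal a => some a
    | .nonterminal _ => none) u

theorem nonterminals_singleton {T N : Type*} (A : N) :
    nonterminals [Symbol.nonterminal (T := T) A] = {A} := rfl

theorem terminals_singleton_nonterminal {T N : Type*} (A : N) :
    terminals [Symbol.nonterminal (T := T) A] = 0 := rfl

theorem nonterminals_append {T N : Type*} (u v : List (Symbol T N)) :
    nonterminals (u ++ v) = nonterminals u + nonterminals v := by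
  simp [nonterminals]

theorem terminals_append {T N : Type*} (u v : List (Symbol T N)) :
    terminals (u ++ v) = terminals u + terminals v := by
  simp [terminals]

theorem nonterminals_map_terminal {T N : Type*} (w : List T) :
    nonterminals (w.map (Symbol.terminal (N := N))) = 0 := by
  simp [nonterminals, List.filterMap_map]

theorem terminals_map_terminal {T N : Type*} (w : List T) :
    terminals (w.map (Symbol.terminal (N := N))) = w := by
  simp [terminals, List.filterMap_map]

theorem mem_nonterminals {T N : Type*} {u : List (Symbol T N)} {A : N} :
    A ∈ nonterminals u ↔ Symbol.nonterminal A ∈ u := by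
  simp only [nonterminals, Multiset.mem_filterMap, Multiset.mem_coe]
  constructor
  · rintro ⟨_ | B, hs, h⟩
    · simp at h
    · simp_all
  · exact fun h => ⟨_, h, rfl⟩

theorem exists_map_terminal {T N : Type*} (u : List (Symbol T N)) (h : nonterminals u = 0) :
    ∃ w : List T, u = w.map Symbol.terminal := by
  induction u with
  | nil => exact ⟨[], rfl⟩
  | cons s u ih =>
    cases s with
    | terminal a =>
      obtain ⟨w, rfl⟩ := ih (by simpa [nonterminals] using h)
      exact ⟨a :: w, rfl⟩
    | nonterminal A => simp [nonterminals] at h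

theorem exists_fires_of_derives {u v : List (Symbol T g.NT)} (h : g.Derives u v) :
    ∃ x : Multiset g.rules,
      Fires (fun r => r.1.input) (fun r => nonterminals r.1.output)
        (nonterminals u) x (nonterminals v) ∧
      terminals v = terminals u + x.bind (fun r => terminals r.1.output) := by
  induction h using Relation.ReflTransGen.head_induction_on with
  | refl => exact ⟨0, .refl _, by simp⟩
  | @head u u' h _ ih =>
    obtain ⟨x, hx, hv⟩ := ih
    obtain ⟨r, hr, hru⟩ := h
    obtain ⟨p, q, rfl, rfl⟩ := hru.exists_parts
    refine ⟨⟨r, hr⟩ ::ₘ x, ?_, ?_⟩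
    · convert! Fires.step (src := fun r : g.rules => r.1.input)
        (tgt := fun r => nonterminals r.1.output) (⟨r, hr⟩ : g.rules)
        (M := nonterminals p + nonterminals q) (x := x) (K := nonterminals v) ?_ using 1
      · simp only [nonterminals_append]
        rw [nonterminals_singleton, ← Multiset.singleton_add, add_right_comm, add_comm]
      · convert! hx using 1
        simp only [nonterminals_append]
        abel
    · rw [hv, Multiset.cons_bind]
      simp only [terminals_append, terminals_singleton_nonterminal]
      abel

/-- Order is irrelevant: a context-free rule applies wherever its nonterminal stands. -/
theorem exists_derives_of_fires {M K : Multiset g.NT} {x : Multiset g.rules}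
    (h : Fires (fun r : g.rules => r.1.input) (fun r => nonterminals r.1.output) M x K)
    (u : List (Symbol T g.NT)) (hu : nonterminals u = M) :
    ∃ v, g.Derives u v ∧ nonterminals v = K ∧
      terminals v = terminals u + x.bind (fun r => terminals r.1.output) := by
  induction h generalizing u with
  | refl M => exact ⟨u, .refl u, hu, by simp⟩
  | @step r M K x h ih =>
    have hmem : Symbol.nonterminal r.1.input ∈ u :=
      mem_nonterminals.1 (hu ▸ Multiset.mem_cons_self _ _)
    obtain ⟨p, q, rfl⟩ := List.append_of_mem hmem
    rw [← List.singleton_append, ← List.append_assoc] at hu ⊢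
    simp only [nonterminals_append, nonterminals_singleton] at hu
    rw [add_right_comm, add_comm, Multiset.singleton_add, Multiset.cons_inj_right] at hu
    obtain ⟨v, huv, hvK, hv⟩ := ih (p ++ r.1.output ++ q) (by
      simp only [nonterminals_append, ← hu]; abel)
    refine ⟨v, Produces.trans_derives ⟨r.1, r.2, r.1.rewrites_of_exists_parts p q⟩ huv, hvK, ?_⟩
    rw [hv, Multiset.cons_bind]
    simp only [terminals_append, terminals_singleton_nonterminal]
    abel

end ContextFreeGrammar

open ContextFreeGrammar in
theorem corollary2 {α : Type*} [Finite α] [DecidableEq α] (L : Language α)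
    (hL : L.IsContextFree) : IsSemilinearSet (parikhImage L) := by
  obtain ⟨g, rfl⟩ := hL
  let f : Multiset g.rules →+ (α → ℕ) :=
    { toFun := fun x a => (x.bind fun r => terminals r.1.output).count a
      map_zero' := by ext; simp
      map_add' := fun x y => by ext; simp [Multiset.add_bind] }
  convert! (isSemilinearSet_setOf_fires (fun r : g.rules => r.1.input)
    (fun r => nonterminals r.1.output) {g.initial} 0).image f using 1
  ext v
  constructor
  · rintro ⟨w, hw, rfl⟩
    obtain ⟨x, hx, hxw⟩ := exists_fires_of_derives hw
    rw [nonterminals_singleton, nonterminals_map_terminal] at hx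
    rw [terminals_singleton_nonterminal, terminals_map_terminal, zero_add] at hxw
    refine ⟨x, hx, funext fun a => ?_⟩
    change Multiset.count a (x.bind _) = w.count a
    rw [← hxw, Multiset.coe_count]
  · rintro ⟨x, hx, rfl⟩
    obtain ⟨u, hu, hu₀, hux⟩ := exists_derives_of_fires hx _ (nonterminals_singleton _)
    obtain ⟨w, rfl⟩ := exists_map_terminal u hu₀
    rw [terminals_singleton_nonterminal, terminals_map_terminal, zero_add] at hux
    refine ⟨w, hu, funext fun a => ?_⟩
    change w.count a = Multiset.count a (x.bind _)
    rw [← hux, Multiset.coe_count]
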